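/- Let $n\ge 1$, let $B_1,\dots,B_{n+1}$ be independent standard one-dimensional Brownian motions started at $0$, and let \[ \mathcal I_n(t)=B_1(|B_2(|B_3(\cdots(|B_{n+1}(t)|)\cdots)|)|),\qquad t>0, \] be the $n$-times iterated Brownian motion. For $y>0$ and $1\le j\le n$, the random variable $\max_{0\le z\le y}|B_{j+1}(z)|$ has a probability density $q_j(y,\cdot)$ with respect to Lebesgue measure. For every $t>0$, the law of $\max_{0\le s\le t}\mathcal I_n(s)$ restricted to $(0,\infty)$ is absolutely continuous, with density \[ f_t(\beta)=2\int_0^{\infty}\cdots\int_0^{\infty}\frac{e^{-\beta^2/(2y_1)}}{\sqrt{2\pi y_1}}\,q_1(y_2,y_1)\,q_2(y_3,y_2)\cdots q_n(t,y_n)\,dy_1\cdots dy_n,\qquad \beta>0 \] (an iterated integral, the innermost integration being over $y_1$; for $n=1$ the only factor is $q_1(t,y_1)$). For every $\beta>0$, moreover, $f_t(\beta)$ is finite and is the derivative at $\beta$ of the distribution function $b\mapsto \Pr\{\max_{0\le s\le t}\mathcal I_n(s)\le b\}$. -/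

import Mathlib

open MeasureTheory ProbabilityTheory
open scoped NNReal ENNReal

noncomputable section

namespace IteratedBM

variable {Ω : Type*}

/-- The `n`-times iterated process `B₁(|B₂(⋯(|Bₙ₊₁(t)|)⋯)|)`; here `B 0, …, B n` stand for
`B₁, …, Bₙ₊₁`. -/
def iterated : (n : ℕ) → (Fin (n + 1) → ℝ≥0 → Ω → ℝ) → ℝ≥0 → Ω → ℝ
  | 0, B => B 0
  | n + 1, B => fun t ω => B 0 (Real.nnabs (iterated n (fun i => B i.succ) t ω)) ω

/-- The reflecting process `|X(t)|`. -/
def reflecting (X : ℝ≥0 → Ω → ℝ) : ℝ≥0 → Ω → ℝ := fun t ω => |X t ω|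

/-- `max_{0 ≤ s ≤ t} X(s)`. It is a genuine maximum on every continuous path, see
`isGreatest_runningMax`. -/
def runningMax (X : ℝ≥0 → Ω → ℝ) (t : ℝ≥0) (ω : Ω) : ℝ :=
  sSup ((fun s => X s ω) '' Set.Icc 0 t)

theorem isGreatest_runningMax {X : ℝ≥0 → Ω → ℝ} {ω : Ω} (h : Continuous fun s => X s ω)
    (t : ℝ≥0) : IsGreatest ((fun s => X s ω) '' Set.Icc 0 t) (runningMax X t ω) :=
  (isCompact_Icc.image h).isGreatest_sSup ((Set.nonempty_Icc.2 zero_le).image _)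

/-- For processes `W 0, …, W (n-1)` and a function `g` on `[0,∞)`, the iterated integral
`∫₀^∞ ⋯ ∫₀^∞ g(y₁) q₀(y₂, y₁) q₁(y₃, y₂) ⋯ qₙ₋₁(t, yₙ) dy₁ ⋯ dyₙ`,
where `qⱼ(y, ·)` is the probability density of `max_{0 ≤ z ≤ y} |W j (z)|` under `P`. The
innermost integral is the one over `y₁`. -/
def nestedIntegral [MeasurableSpace Ω] (P : Measure Ω) (g : ℝ≥0 → ℝ≥0∞) :
    (n : ℕ) → (Fin n → ℝ≥0 → Ω → ℝ) → ℝ≥0 → ℝ≥0∞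
  | 0, _, t => g t
  | n + 1, W, t => ∫⁻ y in Set.Ioi (0 : ℝ),
      nestedIntegral P g n (fun i => W i.castSucc) y.toNNReal *
        pdf (runningMax (reflecting (W (Fin.last n))) t) P volume y

/-- Twice the `n`-fold integral, over `y₁, …, yₙ ∈ (0,∞)`, of the centred Gaussian density with
variance `y₁` at `β` times the densities at `yⱼ` of the maximum of `|Bⱼ₊₁|` over `[0, yⱼ₊₁]`,
`j = 1, …, n`, where `yₙ₊₁ = t`. -/
def maxDensity [MeasurableSpace Ω] (P : Measure Ω) (n : ℕ) (B : Fin (n + 1) → ℝ≥0 → Ω → ℝ)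
    (t : ℝ≥0) (β : ℝ) : ℝ≥0∞ :=
  2 * nestedIntegral P (fun y => gaussianPDF 0 y β) n (fun j => B j.succ) t

end IteratedBM

end

/-! A continuous path started at `0` has a modulus that maps `[0, y]` onto `[0, M(y)]`, where `M(y)`
is the maximum of that modulus (intermediate value theorem). Applied to the inner paths one after
another, this shows that the maximum of the iterated process over `[0, t]` is the maximum of `B 0`
over `[0, C]`, with `C = M₁(M₂(⋯ Mₙ(t)))` built from the other paths (`runningMax_iterated`).

The time `C` is independent of `B 0`. Given `C = y`, the reflection principle (`map_runningMax`)
makes the maximum distributed as the modulus of a centred Gaussian of variance `y`, so Tonelli gives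
the density `2 E[gaussianPDF 0 C β]` on `(0, ∞)` (`prod_runningMax_apply`). Integrating out one path
at a time turns this expectation into the nested integral (`nestedIntegral_eq_lintegral_chain`).

The Gaussian density at `β > 0` is at most `1/β` whatever the variance. Hence the mixture is finite
and, by dominated convergence, continuous in `β`, and the fundamental theorem of calculus gives the
derivative. -/

namespace IteratedBM

open Filter Topology

/-! ### Symmetry of the centred Gaussian law. -/

section Gaussian

lemma gaussianReal_neg_preimage (v : ℝ≥0) {A : Set ℝ} (hA : MeasurableSet A) :
    gaussianReal 0 v ((fun x => -x) ⁻¹' A) = gaussianReal 0 v A := by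
  rw [← Measure.map_apply measurable_neg hA, gaussianReal_map_neg, neg_zero]

lemma gaussianReal_Iio_neg (v : ℝ≥0) (b : ℝ) :
    gaussianReal 0 v (Set.Iio (-b)) = gaussianReal 0 v (Set.Ioi b) := by
  rw [← gaussianReal_neg_preimage v measurableSet_Ioi]
  congr 1
  ext x
  simp

lemma gaussianReal_Iic_neg (v : ℝ≥0) (b : ℝ) :
    gaussianReal 0 v (Set.Iic (-b)) = gaussianReal 0 v (Set.Ici b) := by
  rw [← gaussianReal_neg_preimage v measurableSet_Ici]
  congr 1
  ext x
  simp

/-- The half-line is open here and closed in the next bound because the variance may be `0`: the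
increment from `s k` to `s N` vanishes when `k = N`. -/
lemma two_mul_gaussianReal_Ioi_zero_le (v : ℝ≥0) :
    2 * gaussianReal 0 v (Set.Ioi 0) ≤ 1 := by
  have h := gaussianReal_Iio_neg v 0
  rw [neg_zero] at h
  rw [two_mul]
  nth_rw 2 [← h]
  rw [← measure_union (Set.disjoint_left.2 fun x hx hx' =>
    lt_asymm (Set.mem_Ioi.1 hx) (Set.mem_Iio.1 hx')) measurableSet_Iio]
  exact prob_le_one

lemma one_le_two_mul_gaussianReal_Ici_zero (v : ℝ≥0) :
    1 ≤ 2 * gaussianReal 0 v (Set.Ici 0) := by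
  have h := gaussianReal_Iic_neg v 0
  rw [neg_zero] at h
  rw [two_mul]
  nth_rw 2 [← h]
  calc 1 = gaussianReal 0 v (Set.Ici 0 ∪ Set.Iic 0) := by
        rw [Set.union_comm, Set.Iic_union_Ici, measure_univ]
    _ ≤ _ := measure_union_le _ _

lemma gaussianReal_map_abs_apply (v : ℝ≥0) {A : Set ℝ} (hA : MeasurableSet A)
    (hA0 : A ⊆ Set.Ioi 0) :
    (gaussianReal 0 v).map (fun x => |x|) A = 2 * gaussianReal 0 v A := by
  rw [Measure.map_apply (by fun_prop) hA, two_mul]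
  nth_rw 2 [← gaussianReal_neg_preimage v hA]
  rw [← measure_union (Set.disjoint_left.2 fun x hx hx' => by
    have h1 : 0 < x := hA0 hx
    have h2 : 0 < -x := hA0 hx'
    linarith) (measurable_neg hA)]
  congr 1
  ext x
  simp only [Set.mem_preimage, Set.mem_union]
  constructor
  · intro h
    rcases abs_choice x with h' | h' <;> rw [h'] at h
    · exact Or.inl h
    · exact Or.inr h
  · rintro (h | h)
    · rwa [abs_of_pos (hA0 h)]
    · rwa [abs_of_neg (neg_pos.1 (hA0 h))]

lemma gaussianReal_map_abs_absolutelyContinuous {v : ℝ≥0} (hv : v ≠ 0) :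
    (gaussianReal 0 v).map (fun x => |x|) ≪ volume := by
  refine Measure.AbsolutelyContinuous.mk fun A hA hA0 => ?_
  have h := gaussianReal_absolutelyContinuous 0 hv hA0
  rw [Measure.map_apply (by fun_prop) hA]
  refine measure_mono_null (t := A ∪ (fun x => -x) ⁻¹' A) (fun x hx => ?_)
    (measure_union_null h ((gaussianReal_neg_preimage v hA).trans h))
  rcases abs_choice x with h' | h' <;> simp only [Set.mem_preimage, h'] at hx
  · exact Or.inl hx
  · exact Or.inr hx

end Gaussian

/-! ### Discrete reflection inequalities via first passage. -/

section Reflection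

variable {Ω : Type*} {X : ℝ≥0 → Ω → ℝ}

/-- The event that `k` is the first index at which the process, sampled at the times `s`,
exceeds the level `b`. -/
def firstPassage (X : ℝ≥0 → Ω → ℝ) (s : ℕ → ℝ≥0) (b : ℝ) (k : ℕ) : Set Ω :=
  {ω | (∀ i < k, X (s i) ω ≤ b) ∧ b < X (s k) ω}

lemma disjoint_firstPassage (s : ℕ → ℝ≥0) (b : ℝ) {j k : ℕ} (hjk : j ≠ k) :
    Disjoint (firstPassage X s b j) (firstPassage X s b k) := by
  refine Set.disjoint_left.2 fun ω h h' => ?_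
  rcases lt_or_gt_of_ne hjk with hlt | hlt
  · exact absurd (h'.1 j hlt) (not_le.2 h.2)
  · exact absurd (h.1 k hlt) (not_le.2 h'.2)

lemma biUnion_firstPassage (s : ℕ → ℝ≥0) (b : ℝ) (N : ℕ) :
    ⋃ k ∈ Finset.range (N + 1), firstPassage X s b k = {ω | ∃ k ≤ N, b < X (s k) ω} := by
  classical
  ext ω
  simp only [Finset.mem_range, Set.mem_iUnion, exists_prop, Set.mem_ofPred_eq, Nat.lt_succ_iff]
  constructor
  · rintro ⟨k, hk, h⟩
    exact ⟨k, hk, h.2⟩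
  · intro h
    have h' : ∃ k, b < X (s k) ω := h.imp fun _ => And.right
    refine ⟨Nat.find h', ?_, fun i hi => not_lt.1 (Nat.find_min h' hi), Nat.find_spec h'⟩
    obtain ⟨k, hk, hkb⟩ := h
    exact (Nat.find_min' h' hkb).trans hk

variable [MeasurableSpace Ω] {P : Measure Ω}

lemma measurableSet_firstPassage (hm : ∀ t, Measurable (X t)) (s : ℕ → ℝ≥0) (b : ℝ) (k : ℕ) :
    MeasurableSet (firstPassage X s b k) := by
  have : {ω | ∀ i < k, X (s i) ω ≤ b} = ⋂ i, ⋂ (_ : i < k), {ω | X (s i) ω ≤ b} := by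
    ext; simp
  refine MeasurableSet.inter (s₁ := {ω | ∀ i < k, X (s i) ω ≤ b}) ?_
    (measurableSet_lt measurable_const (hm _))
  exact this ▸ MeasurableSet.iInter fun i => MeasurableSet.iInter fun _ =>
    measurableSet_le (hm _) measurable_const

lemma sum_measure_firstPassage (hm : ∀ t, Measurable (X t)) (s : ℕ → ℝ≥0) (b : ℝ) (N : ℕ) :
    ∑ k ∈ Finset.range (N + 1), P (firstPassage X s b k) = P {ω | ∃ k ≤ N, b < X (s k) ω} := by
  rw [← biUnion_firstPassage, measure_biUnion_finset]
  · exact fun j _ k _ hjk => disjoint_firstPassage s b hjk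
  · exact fun k _ => measurableSet_firstPassage hm s b k

/-- The increment of a Brownian motion after the sampling time `s k` is independent of the event
that the first passage occurs at `s k`. -/
lemma measure_firstPassage_inter (hX : IsPreBrownianReal X P) {s : ℕ → ℝ≥0} (hs : Monotone s)
    (b : ℝ) {k N : ℕ} (hkN : k ≤ N) {A : Set ℝ} (hA : MeasurableSet A) :
    P (firstPassage X s b k ∩ {ω | X (s N) ω - X (s k) ω ∈ A}) =
      P (firstPassage X s b k) * gaussianReal 0 (s N - s k) A := by
  have hle := hs hkN
  have hshift := (hX.shift (s k)).hasLaw_eval (s N - s k)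
  rw [add_tsub_cancel_of_le hle] at hshift
  -- The first-passage event depends only on the path up to time `s k`, hence is independent of the
  -- shifted process.
  set C : Set (Set.Iic (s k) → ℝ) :=
    {f | (∀ i, ∀ hi : i < k, f ⟨s i, hs hi.le⟩ ≤ b) ∧ b < f ⟨s k, Set.self_mem_Iic⟩} with hC
  have hCm : MeasurableSet C := by
    have : {f : Set.Iic (s k) → ℝ | ∀ i, ∀ hi : i < k, f ⟨s i, hs hi.le⟩ ≤ b} =
        ⋂ i, ⋂ (hi : i < k), {f | f ⟨s i, hs hi.le⟩ ≤ b} := by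
      ext; simp
    refine MeasurableSet.inter
      (s₁ := {f : Set.Iic (s k) → ℝ | ∀ i, ∀ hi : i < k, f ⟨s i, hs hi.le⟩ ≤ b}) ?_
      (measurableSet_lt measurable_const (measurable_pi_apply _))
    exact this ▸ MeasurableSet.iInter fun i => MeasurableSet.iInter fun _ =>
      measurableSet_le (measurable_pi_apply _) measurable_const
  have hind := (hX.indepFun_shift (s k)).measure_inter_preimage_eq_mul
    ((fun f => f (s N - s k)) ⁻¹' A) C (measurable_pi_apply _ hA) hCm
  have h1 : (fun ω t => X (s k + t) ω - X (s k) ω) ⁻¹' ((fun f => f (s N - s k)) ⁻¹' A) =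
      {ω | X (s N) ω - X (s k) ω ∈ A} := by
    ext ω
    simp [add_tsub_cancel_of_le hle]
  have h2 : (fun ω (t : Set.Iic (s k)) => X t ω) ⁻¹' C = firstPassage X s b k := by
    ext ω
    simp [hC, firstPassage]
  rw [h1, h2] at hind
  rw [Set.inter_comm, hind, mul_comm]
  congr 1
  exact hshift.measure_eq (p := (· ∈ A)) hA

/-- After a first passage at `s k`, the remaining increment is nonnegative with conditional
probability at least `1/2`, and then the endpoint is above `b`. -/
lemma measure_exists_lt_le (hX : IsPreBrownianReal X P) (hm : ∀ t, Measurable (X t))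
    {s : ℕ → ℝ≥0} (hs : Monotone s) (b : ℝ) (N : ℕ) :
    P {ω | ∃ k ≤ N, b < X (s k) ω} ≤ 2 * P {ω | b < X (s N) ω} := by
  have hmA (k : ℕ) : MeasurableSet (firstPassage X s b k ∩
      {ω | X (s N) ω - X (s k) ω ∈ Set.Ici 0}) :=
    (measurableSet_firstPassage hm s b k).inter (((hm _).sub (hm _)) measurableSet_Ici)
  calc P {ω | ∃ k ≤ N, b < X (s k) ω}
      = ∑ k ∈ Finset.range (N + 1), P (firstPassage X s b k) :=
        (sum_measure_firstPassage hm s b N).symm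
    _ ≤ ∑ k ∈ Finset.range (N + 1), 2 * P (firstPassage X s b k ∩
          {ω | X (s N) ω - X (s k) ω ∈ Set.Ici 0}) := by
        refine Finset.sum_le_sum fun k hk => ?_
        rw [measure_firstPassage_inter hX hs b (Nat.lt_succ_iff.1 (Finset.mem_range.1 hk))
          measurableSet_Ici, mul_left_comm]
        exact le_mul_of_one_le_right' (one_le_two_mul_gaussianReal_Ici_zero _)
    _ = 2 * P (⋃ k ∈ Finset.range (N + 1), firstPassage X s b k ∩
          {ω | X (s N) ω - X (s k) ω ∈ Set.Ici 0}) := by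
        rw [← Finset.mul_sum, measure_biUnion_finset _ fun k _ => hmA k]
        exact fun j _ k _ hjk => (disjoint_firstPassage s b hjk).mono
          Set.inter_subset_left Set.inter_subset_left
    _ ≤ 2 * P {ω | b < X (s N) ω} := by
        gcongr
        simp only [Set.iUnion_subset_iff]
        rintro k - ω ⟨h1, h2⟩
        simp only [Set.mem_ofPred_eq, Set.mem_Ici] at h2 ⊢
        linarith [h1.2]

/-- If no step reaches `ε`, the path overshoots `b` by less than `ε` at first passage. Ending above
`b + ε` then forces a positive remaining increment, of conditional probability at most `1/2`. -/
lemma two_mul_measure_lt_le (hX : IsPreBrownianReal X P) (hm : ∀ t, Measurable (X t))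
    (h0 : ∀ ω, X 0 ω = 0) {s : ℕ → ℝ≥0} (hs : Monotone s) (hs0 : s 0 = 0) {b ε : ℝ} (hb : 0 ≤ b)
    (hε : 0 < ε) (N : ℕ) :
    2 * P {ω | b + ε < X (s N) ω} ≤ P {ω | ∃ k ≤ N, b < X (s k) ω} +
      2 * P {ω | ∃ k < N, ε ≤ X (s (k + 1)) ω - X (s k) ω} := by
  have hsub : {ω | b + ε < X (s N) ω} ⊆ (⋃ k ∈ Finset.range (N + 1), firstPassage X s b k ∩
      {ω | X (s N) ω - X (s k) ω ∈ Set.Ioi 0}) ∪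
        {ω | ∃ k < N, ε ≤ X (s (k + 1)) ω - X (s k) ω} := by
    intro ω hω
    by_cases hE : ∃ k < N, ε ≤ X (s (k + 1)) ω - X (s k) ω
    · exact Or.inr hE
    push Not at hE
    refine Or.inl ?_
    have hmem : ω ∈ {ω | ∃ k ≤ N, b < X (s k) ω} :=
      ⟨N, le_rfl, lt_trans (by linarith) (Set.mem_ofPred_eq ▸ hω)⟩
    rw [← biUnion_firstPassage] at hmem
    simp only [Set.mem_iUnion, Finset.mem_range, exists_prop] at hmem ⊢
    obtain ⟨k, hk, hkω⟩ := hmem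
    refine ⟨k, hk, hkω, ?_⟩
    -- Index `0` is impossible, as the path starts at `0 ≤ b`; otherwise the previous sample is at
    -- most `b`.
    rcases k with _ | k
    · have := hkω.2
      rw [hs0, h0] at this
      linarith
    · have h1 := hE k (by omega)
      have h2 := hkω.1 k (Nat.lt_succ_self k)
      simp only [Set.mem_ofPred_eq, Set.mem_Ioi] at hω ⊢
      linarith
  calc 2 * P {ω | b + ε < X (s N) ω}
      ≤ 2 * (∑ k ∈ Finset.range (N + 1), P (firstPassage X s b k ∩
          {ω | X (s N) ω - X (s k) ω ∈ Set.Ioi 0}) +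
        P {ω | ∃ k < N, ε ≤ X (s (k + 1)) ω - X (s k) ω}) := by
        gcongr
        refine (measure_mono hsub).trans ((measure_union_le _ _).trans ?_)
        gcongr
        exact measure_biUnion_finset_le _ _
    _ ≤ _ := by
        rw [mul_add, ← sum_measure_firstPassage hm s b N, Finset.mul_sum]
        gcongr with k hk
        rw [measure_firstPassage_inter hX hs b (Nat.lt_succ_iff.1 (Finset.mem_range.1 hk))
          measurableSet_Ioi, mul_left_comm]
        exact mul_le_of_le_one_right' (two_mul_gaussianReal_Ioi_zero_le _)

end Reflection

/-! ### Running maxima of continuous paths: grids and measurability. -/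

section Paths

variable {Ω : Type*} {X : ℝ≥0 → Ω → ℝ} {ω : Ω}

lemma lt_runningMax_iff (h : Continuous fun s => X s ω) (t : ℝ≥0) (b : ℝ) :
    b < runningMax X t ω ↔ ∃ s ≤ t, b < X s ω := by
  have hg := isGreatest_runningMax h t
  constructor
  · intro hb
    obtain ⟨s, hs, hsX⟩ := hg.1
    exact ⟨s, hs.2, hb.trans_eq hsX.symm⟩
  · rintro ⟨s, hs, hb⟩
    exact hb.trans_le (hg.2 ⟨s, ⟨zero_le, hs⟩, rfl⟩)

lemma le_runningMax (h : Continuous fun s => X s ω) {s t : ℝ≥0} (hst : s ≤ t) :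
    X s ω ≤ runningMax X t ω :=
  (isGreatest_runningMax h t).2 ⟨s, ⟨zero_le, hst⟩, rfl⟩

/-- The points `k t / (N + 1)` of the uniform grid on `[0, t]`. -/
noncomputable def grid (t : ℝ≥0) (N k : ℕ) : ℝ≥0 := k / (N + 1 : ℕ) * t

lemma monotone_grid (t : ℝ≥0) (N : ℕ) : Monotone (grid t N) := fun i j hij => by
  unfold grid
  gcongr

lemma grid_zero (t : ℝ≥0) (N : ℕ) : grid t N 0 = 0 := by simp [grid]

lemma grid_last (t : ℝ≥0) (N : ℕ) : grid t N (N + 1) = t := by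
  have : ((N + 1 : ℕ) : ℝ≥0) ≠ 0 := by positivity
  simp only [grid]
  rw [div_self this, one_mul]

lemma eventually_exists_lt_grid {f : ℝ≥0 → ℝ} (hf : Continuous f) {s t : ℝ≥0} (hst : s ≤ t) {b : ℝ}
    (hb : b < f s) : ∀ᶠ N : ℕ in atTop, ∃ k ≤ N + 1, b < f (grid t N k) := by
  rcases eq_or_ne t 0 with rfl | ht
  · obtain rfl : s = 0 := le_antisymm hst zero_le
    exact Eventually.of_forall fun N => ⟨0, zero_le, by rwa [grid_zero]⟩
  have hu1 : (s / t : ℝ≥0) ≤ 1 := div_le_one_of_le₀ hst zero_le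
  -- This index picks the last grid point not after `s`, which converges to `s`.
  have hgrid : Tendsto (fun N : ℕ => grid t N ⌊((s / t : ℝ≥0) : ℝ) * ((N + 1 : ℕ) : ℝ)⌋₊) atTop
      (𝓝 s) := by
    have h := ((tendsto_nat_floor_mul_div_atTop (R := ℝ) (s / t).coe_nonneg).comp
      (tendsto_natCast_atTop_atTop.comp (tendsto_add_atTop_nat 1))).mul_const (t : ℝ)
    rw [← NNReal.coe_mul, div_mul_cancel₀ _ ht] at h
    rw [← NNReal.tendsto_coe]
    exact h
  filter_upwards [((hf.tendsto s).comp hgrid).eventually_const_lt hb] with N hN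
  exact ⟨_, Nat.floor_le_of_le (mul_le_of_le_one_left (Nat.cast_nonneg _) (mod_cast hu1)), hN⟩

lemma eventually_grid_sub_lt {f : ℝ≥0 → ℝ} (hf : Continuous f) (t : ℝ≥0) {ε : ℝ} (hε : 0 < ε) :
    ∀ᶠ N : ℕ in atTop, ∀ k < N + 1, f (grid t N (k + 1)) - f (grid t N k) < ε := by
  have huc := (isCompact_Icc (a := (0 : ℝ≥0)) (b := t)).uniformContinuousOn_of_continuous
    hf.continuousOn
  obtain ⟨δ, hδ, h⟩ := Metric.uniformContinuousOn_iff.1 huc ε hε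
  have hlim : Tendsto (fun N : ℕ => (t : ℝ) / ((N : ℝ) + 1)) atTop (𝓝 0) :=
    tendsto_const_nhds.div_atTop (tendsto_natCast_atTop_atTop.atTop_add tendsto_const_nhds)
  filter_upwards [hlim.eventually_lt_const hδ] with N hN k hk
  have hmem (j : ℕ) (hj : j ≤ N + 1) : grid t N j ∈ Set.Icc 0 t :=
    ⟨zero_le, (monotone_grid t N hj).trans_eq (grid_last t N)⟩
  have hd : dist (grid t N (k + 1)) (grid t N k) < δ := by
    refine lt_of_eq_of_lt ?_ hN
    rw [NNReal.dist_eq]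
    have : ((grid t N (k + 1) : ℝ≥0) : ℝ) - grid t N k = t / (N + 1) := by
      simp only [grid, NNReal.coe_mul, NNReal.coe_div, NNReal.coe_natCast]
      push_cast
      ring
    rw [this, abs_of_nonneg (by positivity)]
  exact (le_abs_self _).trans_lt (h _ (hmem _ hk) _ (hmem _ hk.le) hd)

/-- This yields absolute continuity of the maximum of `|X|` from that of the maxima of `X` and `-X`,
without computing its law. -/
lemma runningMax_reflecting_eq_or (hc : Continuous fun s => X s ω) (t : ℝ≥0) :
    runningMax (reflecting X) t ω = runningMax X t ω ∨
      runningMax (reflecting X) t ω = runningMax (-X) t ω := by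
  have hc' : Continuous fun s => (-X) s ω := hc.neg
  have hca : Continuous fun s => reflecting X s ω := hc.abs
  obtain ⟨s, hs, hsX⟩ := (isGreatest_runningMax hca t).1
  have h1 : runningMax X t ω ≤ runningMax (reflecting X) t ω := by
    obtain ⟨r, hr, hrX⟩ := (isGreatest_runningMax hc t).1
    rw [← hrX]
    exact (le_abs_self _).trans (le_runningMax hca hr.2)
  have h2 : runningMax (-X) t ω ≤ runningMax (reflecting X) t ω := by
    obtain ⟨r, hr, hrX⟩ := (isGreatest_runningMax hc' t).1
    rw [← hrX]
    exact (neg_le_abs _).trans (le_runningMax hca hr.2)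
  simp only [reflecting] at hsX
  rcases abs_choice (X s ω) with h | h <;> rw [h] at hsX
  · exact Or.inl (le_antisymm (hsX ▸ le_runningMax hc hs.2) h1)
  · exact Or.inr (le_antisymm (hsX ▸ le_runningMax hc' hs.2) h2)

/-- By continuity countably many times suffice; capping each dense time at `t` makes the index set
independent of `t`. -/
lemma measurable_runningMax_uncurry [MeasurableSpace Ω] (hc : ∀ ω, Continuous fun s => X s ω)
    (hm : ∀ t, Measurable (X t)) : Measurable fun p : ℝ≥0 × Ω => runningMax X p.1 p.2 := by
  have hX : Measurable (Function.uncurry X) := measurable_uncurry_of_continuous_of_measurable hc hm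
  refine measurable_of_Ioi fun b => ?_
  have : (fun p : ℝ≥0 × Ω => runningMax X p.1 p.2) ⁻¹' Set.Ioi b =
      ⋃ k : ℕ, {p : ℝ≥0 × Ω | b < X (min (TopologicalSpace.denseSeq ℝ≥0 k) p.1) p.2} := by
    ext ⟨t, ω⟩
    simp only [Set.mem_preimage, Set.mem_Ioi, lt_runningMax_iff (hc ω), Set.mem_iUnion,
      Set.mem_ofPred_eq]
    constructor
    · rintro ⟨s, hs, hb⟩
      have hopen : IsOpen {u : ℝ≥0 | b < X (min u t) ω} :=
        isOpen_lt continuous_const ((hc ω).comp (continuous_id.min continuous_const))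
      obtain ⟨u, hu, k, rfl⟩ := (TopologicalSpace.denseRange_denseSeq ℝ≥0).inter_open_nonempty _
        hopen ⟨s, by simpa [min_eq_left hs] using hb⟩
      exact ⟨k, hu⟩
    · rintro ⟨k, hk⟩
      exact ⟨_, min_le_right _ _, hk⟩
  rw [this]
  refine MeasurableSet.iUnion fun k => measurableSet_lt measurable_const ?_
  exact hX.comp ((measurable_const.min measurable_fst).prodMk measurable_snd)

lemma measurable_runningMax [MeasurableSpace Ω] (hc : ∀ ω, Continuous fun s => X s ω)
    (hm : ∀ t, Measurable (X t)) (t : ℝ≥0) : Measurable (runningMax X t) :=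
  (measurable_runningMax_uncurry hc hm).comp measurable_prodMk_left

end Paths

/-! ### The reflection principle in continuous time. -/

section ReflectionPrinciple

variable {Ω : Type*} [MeasurableSpace Ω] {P : Measure Ω} [IsProbabilityMeasure P]
  {X : ℝ≥0 → Ω → ℝ}

/-- The uniform grids are not nested, so the events need not increase; their indicators still
converge pointwise. -/
lemma tendsto_measure_exists_lt_grid (hc : ∀ ω, Continuous fun s => X s ω)
    (hm : ∀ t, Measurable (X t)) (t : ℝ≥0) (b : ℝ) :
    Tendsto (fun N : ℕ => P {ω | ∃ k ≤ N + 1, b < X (grid t N k) ω}) atTop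
      (𝓝 (P {ω | b < runningMax X t ω})) := by
  refine tendsto_measure_of_tendsto_indicator_of_isFiniteMeasure atTop P (fun N => ?_) fun ω => ?_
  · rw [← biUnion_firstPassage]
    exact Finset.measurableSet_biUnion _ fun k _ => measurableSet_firstPassage hm _ b k
  · by_cases h : b < runningMax X t ω
    · obtain ⟨s, hs, hb⟩ := (lt_runningMax_iff (hc ω) t b).1 h
      filter_upwards [eventually_exists_lt_grid (hc ω) hs hb] with N hN
      exact iff_of_true hN h
    · refine Eventually.of_forall fun N => iff_of_false ?_ h
      rintro ⟨k, hk, hb⟩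
      exact h ((lt_runningMax_iff (hc ω) t b).2
        ⟨_, (monotone_grid t N hk).trans_eq (grid_last t N), hb⟩)

lemma tendsto_measure_exists_le_grid_sub (hc : ∀ ω, Continuous fun s => X s ω)
    (hm : ∀ t, Measurable (X t)) (t : ℝ≥0) {ε : ℝ} (hε : 0 < ε) :
    Tendsto (fun N : ℕ => P {ω | ∃ k < N + 1, ε ≤ X (grid t N (k + 1)) ω - X (grid t N k) ω})
      atTop (𝓝 0) := by
  rw [← measure_empty (μ := P)]
  refine tendsto_measure_of_tendsto_indicator_of_isFiniteMeasure atTop P (fun N => ?_) fun ω => ?_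
  · have : {ω | ∃ k < N + 1, ε ≤ X (grid t N (k + 1)) ω - X (grid t N k) ω} =
        ⋃ k, ⋃ (_ : k < N + 1), {ω | ε ≤ X (grid t N (k + 1)) ω - X (grid t N k) ω} := by
      ext; simp
    exact this ▸ MeasurableSet.iUnion fun k => MeasurableSet.iUnion fun _ =>
      measurableSet_le measurable_const ((hm _).sub (hm _))
  · filter_upwards [eventually_grid_sub_lt (hc ω) t hε] with N hN
    refine iff_of_false ?_ (Set.notMem_empty ω)
    rintro ⟨k, hk, h⟩
    exact (hN k hk).not_ge h

/-- The **reflection principle** for the tail of the running maximum. -/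
lemma measure_lt_runningMax (hX : IsPreBrownianReal X P) (hc : ∀ ω, Continuous fun s => X s ω)
    (hm : ∀ t, Measurable (X t)) (h0 : ∀ ω, X 0 ω = 0) (t : ℝ≥0) {b : ℝ} (hb : 0 ≤ b) :
    P {ω | b < runningMax X t ω} = 2 * P {ω | b < X t ω} := by
  have hlim := tendsto_measure_exists_lt_grid (P := P) hc hm t b
  refine le_antisymm (le_of_tendsto' hlim fun N => ?_) ?_
  · simpa only [grid_last] using measure_exists_lt_le hX hm (monotone_grid t N) b (N + 1)
  -- The mesh tends to zero with `ε` fixed, which removes the large-step error; only afterwards does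
  -- `ε` decrease to `0`.
  have hε (ε : ℝ) (hε : 0 < ε) : 2 * P {ω | b + ε < X t ω} ≤ P {ω | b < runningMax X t ω} := by
    have h2 := hlim.add (ENNReal.Tendsto.const_mul (a := 2)
      (tendsto_measure_exists_le_grid_sub (P := P) hc hm t hε) (Or.inr (by simp)))
    rw [mul_zero, add_zero] at h2
    refine ge_of_tendsto' h2 fun N => ?_
    simpa only [grid_last] using
      two_mul_measure_lt_le hX hm h0 (monotone_grid t N) (grid_zero t N) hb hε (N + 1)
  have hU : {ω | b < X t ω} = ⋃ n : ℕ, {ω | b + 1 / ((n : ℝ) + 1) < X t ω} := by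
    ext ω
    simp only [Set.mem_ofPred_eq, Set.mem_iUnion]
    constructor
    · intro h
      obtain ⟨n, hn⟩ := exists_nat_one_div_lt (sub_pos.2 h)
      exact ⟨n, by linarith⟩
    · rintro ⟨n, hn⟩
      have : 0 < 1 / ((n : ℝ) + 1) := Nat.one_div_pos_of_nat
      linarith
  have hmono : Monotone fun n : ℕ => {ω | b + 1 / ((n : ℝ) + 1) < X t ω} := by
    intro n m hnm ω hω
    have := Nat.one_div_le_one_div (α := ℝ) hnm
    simp only [Set.mem_ofPred_eq] at hω ⊢
    linarith
  rw [hU]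
  exact le_of_tendsto' (ENNReal.Tendsto.const_mul (tendsto_measure_iUnion_atTop hmono)
    (Or.inr (by simp))) fun n => hε _ Nat.one_div_pos_of_nat

/-- The **reflection principle**: the running maximum of a Brownian motion at time `t` has the law
of the absolute value of a centred Gaussian variable of variance `t`. -/
lemma map_runningMax (hX : IsPreBrownianReal X P) (hc : ∀ ω, Continuous fun s => X s ω)
    (hm : ∀ t, Measurable (X t)) (h0 : ∀ ω, X 0 ω = 0) (t : ℝ≥0) :
    P.map (runningMax X t) = (gaussianReal 0 t).map (fun x => |x|) := by
  have hM := measurable_runningMax hc hm t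
  have : IsProbabilityMeasure (P.map (runningMax X t)) :=
    Measure.isProbabilityMeasure_map hM.aemeasurable
  have habs : Measurable fun x : ℝ => |x| := by fun_prop
  have : IsProbabilityMeasure ((gaussianReal 0 t).map fun x => |x|) :=
    Measure.isProbabilityMeasure_map habs.aemeasurable
  refine Measure.ext_of_Iic _ _ fun b => ?_
  rcases lt_or_ge b 0 with hb | hb
  · rw [Measure.map_apply hM measurableSet_Iic, Measure.map_apply habs measurableSet_Iic]
    have h1 : runningMax X t ⁻¹' Set.Iic b = ∅ := by
      ext ω
      have := le_runningMax (hc ω) (zero_le : 0 ≤ t)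
      rw [h0] at this
      simp only [Set.mem_preimage, Set.mem_Iic, Set.mem_empty_iff_false, iff_false, not_le]
      linarith
    have h2 : (fun x : ℝ => |x|) ⁻¹' Set.Iic b = ∅ := by
      ext x
      simp only [Set.mem_preimage, Set.mem_Iic, Set.mem_empty_iff_false, iff_false, not_le]
      linarith [abs_nonneg x]
    rw [h1, h2, measure_empty, measure_empty]
  · rw [← Set.compl_Ioi, prob_compl_eq_one_sub measurableSet_Ioi,
      prob_compl_eq_one_sub measurableSet_Ioi,
      gaussianReal_map_abs_apply t measurableSet_Ioi (Set.Ioi_subset_Ioi hb),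
      Measure.map_apply hM measurableSet_Ioi, ← (hX.hasLaw_eval t).map_eq,
      Measure.map_apply (hm t) measurableSet_Ioi]
    exact congrArg (1 - ·) (measure_lt_runningMax hX hc hm h0 t hb)

lemma map_runningMax_absolutelyContinuous (hX : IsPreBrownianReal X P)
    (hc : ∀ ω, Continuous fun s => X s ω) (hm : ∀ t, Measurable (X t)) (h0 : ∀ ω, X 0 ω = 0)
    {t : ℝ≥0} (ht : t ≠ 0) : P.map (runningMax X t) ≪ volume := by
  rw [map_runningMax hX hc hm h0]
  exact gaussianReal_map_abs_absolutelyContinuous ht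

/-- The maximum of a reflecting Brownian motion over a nondegenerate interval has a density. -/
lemma hasPDF_runningMax_reflecting (hX : IsPreBrownianReal X P)
    (hc : ∀ ω, Continuous fun s => X s ω) (hm : ∀ t, Measurable (X t)) (h0 : ∀ ω, X 0 ω = 0)
    {t : ℝ≥0} (ht : t ≠ 0) : HasPDF (runningMax (reflecting X) t) P volume := by
  have hcn : ∀ ω, Continuous fun s => (-X) s ω := fun ω => (hc ω).neg
  have hmn : ∀ t, Measurable ((-X) t) := fun t => (hm t).neg
  have hM : Measurable (runningMax (reflecting X) t) :=
    measurable_runningMax (fun ω => (hc ω).abs) (fun t => (hm t).abs) t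
  refine ⟨hM.aemeasurable, inferInstance, Measure.AbsolutelyContinuous.mk fun A hA hA0 => ?_⟩
  have h1 := map_runningMax_absolutelyContinuous hX hc hm h0 ht hA0
  have h2 := map_runningMax_absolutelyContinuous hX.neg hcn hmn (by simp [h0]) ht hA0
  rw [Measure.map_apply (measurable_runningMax hc hm t) hA] at h1
  rw [Measure.map_apply (measurable_runningMax hcn hmn t) hA] at h2
  rw [Measure.map_apply hM hA]
  refine measure_mono_null (fun ω hω => ?_) (measure_union_null h1 h2)
  rw [Set.mem_preimage] at hω
  rcases runningMax_reflecting_eq_or (hc ω) t with h | h <;> rw [h] at hω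
  · exact Or.inl hω
  · exact Or.inr hω

end ReflectionPrinciple

/-! ### Path space and the pathwise identity for the iterated maximum. -/

section PathSpace

/-- Continuous paths started at `0`, with the `σ`-algebra generated by the coordinates. -/
abbrev PathSpace : Type := {f : ℝ≥0 → ℝ // Continuous f ∧ f 0 = 0}

/-- The canonical process on the path space. -/
def coord (s : ℝ≥0) (f : PathSpace) : ℝ := f.1 s

lemma continuous_coord (f : PathSpace) : Continuous fun s => coord s f := f.2.1

lemma coord_zero (f : PathSpace) : coord 0 f = 0 := f.2.2

lemma measurable_coord (s : ℝ≥0) : Measurable (coord s) :=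
  (measurable_pi_apply s).comp measurable_subtype_coe

/-- The maximum of the modulus of a path over `[0, t]`. -/
noncomputable def absMax (f : PathSpace) (t : ℝ≥0) : ℝ≥0 :=
  (runningMax (reflecting coord) t f).toNNReal

lemma runningMax_reflecting_coord_nonneg (f : PathSpace) (t : ℝ≥0) :
    0 ≤ runningMax (reflecting coord) t f :=
  (abs_nonneg _).trans (le_runningMax (X := reflecting coord) (continuous_coord f).abs
    (zero_le : 0 ≤ t))

lemma coe_absMax (f : PathSpace) (t : ℝ≥0) :
    (absMax f t : ℝ) = runningMax (reflecting coord) t f :=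
  Real.coe_toNNReal _ (runningMax_reflecting_coord_nonneg f t)

lemma measurable_absMax : Measurable fun p : ℝ≥0 × PathSpace => absMax p.2 p.1 :=
  (measurable_runningMax_uncurry (X := reflecting coord) (fun f => (continuous_coord f).abs)
    fun s => (measurable_coord s).abs).real_toNNReal

/-- The modulus of a path maps `[0, t]` onto `[0, max_{[0, t]} |f|]`. -/
lemma image_nnabs_path (f : PathSpace) (t : ℝ≥0) :
    (fun s => Real.nnabs (f.1 s)) '' Set.Icc 0 t = Set.Icc 0 (absMax f t) := by
  have hca : Continuous fun s => reflecting coord s f := (continuous_coord f).abs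
  have hc : Continuous fun s => Real.nnabs (f.1 s) := f.2.1.abs.subtype_mk _
  apply Set.Subset.antisymm
  · rintro _ ⟨s, hs, rfl⟩
    refine ⟨zero_le, ?_⟩
    rw [← NNReal.coe_le_coe, coe_absMax, Real.coe_nnabs]
    exact le_runningMax hca hs.2
  · obtain ⟨s, hs, hsX⟩ := (isGreatest_runningMax hca t).1
    have h := intermediate_value_Icc (zero_le : 0 ≤ s) hc.continuousOn
    have h0 : Real.nnabs (f.1 0) = 0 := by rw [f.2.2, map_zero]
    have h1 : Real.nnabs (f.1 s) = absMax f t := by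
      rw [← NNReal.coe_inj, coe_absMax, Real.coe_nnabs]
      exact hsX
    rw [h0, h1] at h
    exact h.trans (Set.image_mono (Set.Icc_subset_Icc_right hs.2))

/-- The successive maxima `M₁(M₂(⋯ Mₙ(t)))`, where `Mⱼ(y)` is the maximum over `[0, y]` of the
modulus of the `j`-th path. -/
noncomputable def chain : (n : ℕ) → (Fin n → PathSpace) → ℝ≥0 → ℝ≥0
  | 0, _, t => t
  | n + 1, w, t => chain n (fun i => w i.castSucc) (absMax (w (Fin.last n)) t)

/-- `chain` peels off the innermost path, matching `nestedIntegral`; peeling off the outermost one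
matches `iterated`. -/
lemma chain_succ (n : ℕ) (w : Fin (n + 1) → PathSpace) (t : ℝ≥0) :
    chain (n + 1) w t = absMax (w 0) (chain n (fun i => w i.succ) t) := by
  induction n generalizing t with
  | zero => rfl
  | succ n ih => rw [chain, ih]; rfl

lemma measurable_chain (n : ℕ) :
    Measurable fun p : ℝ≥0 × (Fin n → PathSpace) => chain n p.2 p.1 := by
  induction n with
  | zero => exact measurable_fst
  | succ n ih =>
    refine ih.comp (Measurable.prodMk (measurable_absMax.comp (measurable_fst.prodMk ?_)) ?_)
    · exact (measurable_pi_apply _).comp measurable_snd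
    · exact measurable_pi_lambda _ fun i => (measurable_pi_apply _).comp measurable_snd

lemma measurable_chain_right (n : ℕ) (t : ℝ≥0) : Measurable fun w => chain n w t :=
  (measurable_chain n).comp measurable_prodMk_left

lemma image_nnabs_iterated {Ω : Type*} {ω : Ω} {n : ℕ} {B : Fin (n + 1) → ℝ≥0 → Ω → ℝ}
    (w : Fin (n + 1) → PathSpace) (hw : ∀ j s, B j s ω = (w j).1 s) (t : ℝ≥0) :
    (fun s => Real.nnabs (iterated n B s ω)) '' Set.Icc 0 t = Set.Icc 0 (chain (n + 1) w t) := by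
  induction n with
  | zero =>
    simp only [iterated, hw]
    exact image_nnabs_path (w 0) t
  | succ n ih =>
    rw [chain_succ, ← image_nnabs_path, ← ih (fun i => w i.succ) fun j s => hw j.succ s,
      Set.image_image]
    simp only [iterated, hw]

/-- The maximum of the iterated process over `[0, t]` is the maximum of the outer path over the
interval from `0` to the chain of the maxima of the moduli of the inner paths. -/
lemma runningMax_iterated {Ω : Type*} {ω : Ω} {n : ℕ} {B : Fin (n + 1) → ℝ≥0 → Ω → ℝ}
    (w : Fin (n + 1) → PathSpace) (hw : ∀ j s, B j s ω = (w j).1 s) (t : ℝ≥0) :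
    runningMax (iterated n B) t ω = runningMax coord (chain n (fun i => w i.succ) t) (w 0) := by
  cases n with
  | zero => simp only [runningMax, iterated, hw, coord, chain]
  | succ n =>
    simp only [runningMax]
    rw [← image_nnabs_iterated (fun i => w i.succ) fun j s => hw j.succ s, Set.image_image]
    simp only [iterated, hw, coord]

/-- Off a measurable full set the path is replaced by zero. Measurability is checked at countably
many dense times and passes to the others by continuity. -/
lemma exists_pathSpace_version {Ω : Type*} [MeasurableSpace Ω] {P : Measure Ω}
    {X : ℝ≥0 → Ω → ℝ} (hX : IsBrownianReal X P) :
    ∃ Z : Ω → PathSpace, Measurable Z ∧ ∀ᵐ ω ∂P, ∀ s, X s ω = (Z ω).1 s := by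
  classical
  let d := TopologicalSpace.denseSeq ℝ≥0
  have hae : ∀ᵐ ω ∂P, (Continuous (X · ω) ∧ X 0 ω = 0) ∧
      ∀ k, X (d k) ω = (hX.aemeasurable (d k)).mk _ ω :=
    (hX.cont.and hX.eval_zero_ae_eq_zero).and
      (ae_all_iff.2 fun k => (hX.aemeasurable (d k)).ae_eq_mk)
  obtain ⟨G, hG, hGm, hGood⟩ := hae.exists_measurable_mem
  let Z : Ω → PathSpace := fun ω => if h : ω ∈ G then ⟨fun s => X s ω, (hGood ω h).1⟩
    else ⟨fun _ => 0, continuous_const, rfl⟩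
  have hZG {ω : Ω} (h : ω ∈ G) (s : ℝ≥0) : (Z ω).1 s = X s ω := by simp [Z, h]
  have hZd (k : ℕ) : Measurable fun ω => (Z ω).1 (d k) := by
    have : (fun ω => (Z ω).1 (d k)) = G.indicator ((hX.aemeasurable (d k)).mk _) := by
      ext ω
      by_cases h : ω ∈ G
      · rw [hZG h, Set.indicator_of_mem h, (hGood ω h).2]
      · simp [Z, h]
    exact this ▸ (hX.aemeasurable (d k)).measurable_mk.indicator hGm
  refine ⟨Z, measurable_comap_iff.2 (measurable_pi_iff.2 fun s => ?_), ?_⟩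
  · obtain ⟨u, hu, hus⟩ := mem_closure_iff_seq_limit.1 (TopologicalSpace.denseRange_denseSeq ℝ≥0 s)
    choose k hk using hu
    refine measurable_of_tendsto_metrizable (f := fun m ω => (Z ω).1 (u m)) (fun m => ?_) ?_
    · rw [← hk m]
      exact hZd (k m)
    · exact tendsto_pi_nhds.2 fun ω => ((Z ω).2.1.tendsto s).comp hus
  · filter_upwards [hG] with ω h s using (hZG h s).symm

end PathSpace

/-! ### The nested integral as an expectation over the chain. -/

section Nested

variable {Ω : Type*} [MeasurableSpace Ω] {P : Measure Ω}

lemma nestedIntegral_eq_lintegral_chain {g : ℝ≥0 → ℝ≥0∞} (hg : Measurable g) {n : ℕ}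
    {W : Fin n → ℝ≥0 → Ω → ℝ} (μ : Fin n → Measure PathSpace) [∀ j, IsProbabilityMeasure (μ j)]
    (hpdf : ∀ j, ∀ y : ℝ≥0, 0 < y → HasPDF (runningMax (reflecting (W j)) y) P volume)
    (hmap : ∀ j y, P.map (runningMax (reflecting (W j)) y) =
      (μ j).map (runningMax (reflecting coord) y)) {t : ℝ≥0} (ht : 0 < t) :
    nestedIntegral P g n W t = ∫⁻ w, g (chain n w t) ∂(Measure.pi μ) := by
  induction n generalizing t with
  | zero => simp [nestedIntegral, chain]
  | succ n ih =>
    let H : ℝ≥0 → ℝ≥0∞ := fun y => ∫⁻ w, g (chain n w y) ∂(Measure.pi fun i => μ i.castSucc)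
    have hH : Measurable H := (hg.comp (measurable_chain n)).lintegral_prod_right'
    let K : ℝ → ℝ≥0∞ := (Set.Ioi 0).indicator fun y => H y.toNNReal
    have hK : Measurable K := (hH.comp measurable_real_toNNReal).indicator measurableSet_Ioi
    have hM : Measurable (runningMax (reflecting coord) t) :=
      measurable_runningMax (X := reflecting coord) (fun f => (continuous_coord f).abs)
        (fun s => (measurable_coord s).abs) t
    have hp := hpdf (Fin.last n) t ht
    -- The maximum is nonnegative and, having a density, has no atom at `0`; so the cut-off in `K`
    -- costs nothing.
    have hpos : ∀ᵐ f ∂(μ (Fin.last n)), 0 < runningMax (reflecting coord) t f := by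
      have hne : ∀ᵐ f ∂(μ (Fin.last n)), runningMax (reflecting coord) t f ≠ 0 := by
        have h0 : (μ (Fin.last n)).map (runningMax (reflecting coord) t) {0} = 0 := by
          rw [← hmap]
          exact HasPDF.absolutelyContinuous (Real.volume_singleton)
        rw [Measure.map_apply hM (measurableSet_singleton 0)] at h0
        exact measure_eq_zero_iff_ae_notMem.1 h0
      filter_upwards [hne] with f hf
      exact lt_of_le_of_ne (runningMax_reflecting_coord_nonneg f t) hf.symm
    have hgc : Measurable fun p : PathSpace × (Fin n → PathSpace) =>
        g (chain n p.2 (absMax p.1 t)) :=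
      (hg.comp (measurable_chain n)).comp (Measurable.prodMk
        (measurable_absMax.comp (measurable_const.prodMk measurable_fst)) measurable_snd)
    calc nestedIntegral P g (n + 1) W t
        = ∫⁻ y in Set.Ioi (0 : ℝ), H y.toNNReal *
            pdf (runningMax (reflecting (W (Fin.last n))) t) P volume y := by
          refine setLIntegral_congr_fun measurableSet_Ioi fun y hy => ?_
          simp only [H]
          rw [ih (fun i => μ i.castSucc) (fun j => hpdf j.castSucc) (fun j => hmap j.castSucc)
            (Real.toNNReal_pos.2 hy)]
      _ = ∫⁻ y, pdf (runningMax (reflecting (W (Fin.last n))) t) P volume y * K y := by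
          rw [← lintegral_indicator measurableSet_Ioi]
          refine lintegral_congr fun y => ?_
          by_cases hy : y ∈ Set.Ioi (0 : ℝ) <;> simp [K, hy, mul_comm]
      _ = ∫⁻ ω, K (runningMax (reflecting (W (Fin.last n))) t ω) ∂P :=
          pdf.lintegral_pdf_mul hK.aemeasurable
      _ = ∫⁻ f, K (runningMax (reflecting coord) t f) ∂(μ (Fin.last n)) := by
          rw [← lintegral_map' hK.aemeasurable (HasPDF.aemeasurable _ P volume), hmap,
            lintegral_map hK hM]
      _ = ∫⁻ f, H (absMax f t) ∂(μ (Fin.last n)) := by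
          refine lintegral_congr_ae ?_
          filter_upwards [hpos] with f hf
          simp [K, hf, absMax]
      _ = ∫⁻ p, g (chain n p.2 (absMax p.1 t))
            ∂((μ (Fin.last n)).prod (Measure.pi fun i => μ i.castSucc)) := by
          rw [lintegral_prod _ hgc.aemeasurable]
      _ = ∫⁻ w, g (chain (n + 1) w t) ∂(Measure.pi μ) := by
          have hmp := measurePreserving_piFinSuccAbove μ (Fin.last n)
          simp only [Fin.succAbove_last] at hmp
          rw [← hmp.lintegral_comp hgc]
          refine lintegral_congr fun w => ?_
          simp [chain, MeasurableEquiv.piFinSuccAbove, Fin.insertNthEquiv, Fin.init_def]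

end Nested

/-! ### Regularity of Gaussian variance mixtures. -/

section Density

lemma measurable_gaussianPDF_uncurry :
    Measurable fun p : ℝ≥0 × ℝ => gaussianPDF 0 p.1 p.2 := by
  unfold gaussianPDF gaussianPDFReal
  fun_prop

lemma two_mul_gaussianReal_apply (v : ℝ≥0) {A : Set ℝ} (hA : MeasurableSet A)
    (hA0 : A ⊆ Set.Ioi 0) :
    2 * gaussianReal 0 v A = ∫⁻ β in A, 2 * gaussianPDF 0 v β := by
  rw [lintegral_const_mul _ (measurable_gaussianPDF 0 v)]
  rcases eq_or_ne v 0 with rfl | hv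
  -- For zero variance `gaussianPDF` is identically `0`, while the Dirac mass at `0` does not charge
  -- `A`; so positivity of the chain is not needed.
  · have h0 : (0 : ℝ) ∉ A := fun h => lt_irrefl (0 : ℝ) (Set.mem_Ioi.1 (hA0 h))
    simp [gaussianReal_zero_var, Measure.dirac_apply' _ hA, h0, gaussianPDF]
  · rw [gaussianReal_apply 0 hv]

/-- With `x = β² / (2v)`, the bound `exp (-x) ≤ 1/√x` cancels the variance and leaves `1/√(πβ²)`.
Uniformity in `v` gives both finiteness and domination. -/
lemma gaussianPDFReal_zero_le (v : ℝ≥0) {β : ℝ} (hβ : 0 < β) : gaussianPDFReal 0 v β ≤ β⁻¹ := by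
  rcases eq_or_ne v 0 with rfl | hv
  · simpa using hβ.le
  have hv' : (0 : ℝ) < v := by positivity
  rw [gaussianPDFReal, sub_zero]
  set x : ℝ := β ^ 2 / (2 * v) with hx
  have hx0 : 0 < x := by positivity
  have hexp : Real.exp (-β ^ 2 / (2 * v)) ≤ (√x)⁻¹ := by
    rw [neg_div, Real.exp_neg]
    refine inv_anti₀ (Real.sqrt_pos.2 hx0) ?_
    have h1 : √x ≤ x + 1 := Real.sqrt_le_iff.2 ⟨by positivity, by nlinarith⟩
    exact h1.trans (Real.add_one_le_exp x)
  calc (√(2 * Real.pi * v))⁻¹ * Real.exp (-β ^ 2 / (2 * v))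
      ≤ (√(2 * Real.pi * v))⁻¹ * (√x)⁻¹ := by gcongr
    _ = (√(Real.pi * β ^ 2))⁻¹ := by
        rw [← mul_inv, ← Real.sqrt_mul (by positivity)]
        congr 2
        rw [hx]
        field_simp
    _ ≤ β⁻¹ := by
        refine inv_anti₀ hβ (Real.le_sqrt_of_sq_le ?_)
        nlinarith [Real.pi_gt_three, sq_nonneg β]

lemma lintegral_gaussianPDF_lt_top (ρ : Measure ℝ≥0) [IsProbabilityMeasure ρ] {β : ℝ}
    (hβ : 0 < β) : ∫⁻ y, gaussianPDF 0 y β ∂ρ < ∞ := by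
  refine (lintegral_mono (g := fun _ => ENNReal.ofReal β⁻¹) fun y =>
    ENNReal.ofReal_le_ofReal (gaussianPDFReal_zero_le y hβ)).trans_lt ?_
  simp

lemma continuousAt_toReal_lintegral_gaussianPDF (ρ : Measure ℝ≥0) [IsProbabilityMeasure ρ] {β : ℝ}
    (hβ : 0 < β) : ContinuousAt (fun b => (∫⁻ y, gaussianPDF 0 y b ∂ρ).toReal) β := by
  have hmeas (b : ℝ) : Measurable fun y : ℝ≥0 => gaussianPDFReal 0 y b := by
    unfold gaussianPDFReal
    fun_prop
  have heq : (fun b => (∫⁻ y, gaussianPDF 0 y b ∂ρ).toReal) =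
      fun b => ∫ y, gaussianPDFReal 0 y b ∂ρ := by
    ext b
    rw [integral_eq_lintegral_of_nonneg_ae (ae_of_all _ fun y => gaussianPDFReal_nonneg 0 y b)
      (hmeas b).aestronglyMeasurable]
    rfl
  rw [heq]
  refine continuousAt_of_dominated (bound := fun _ => (β / 2)⁻¹)
    (Eventually.of_forall fun b => (hmeas b).aestronglyMeasurable) ?_ (integrable_const _) ?_
  · filter_upwards [lt_mem_nhds (half_lt_self hβ)] with b hb
    refine ae_of_all _ fun y => ?_
    rw [Real.norm_of_nonneg (gaussianPDFReal_nonneg 0 y b)]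
    exact (gaussianPDFReal_zero_le y ((half_pos hβ).trans hb)).trans
      (inv_anti₀ (half_pos hβ) hb.le)
  · refine ae_of_all _ fun y => ?_
    unfold gaussianPDFReal
    fun_prop

/-- A continuous density on `(0, ∞)` is the derivative of the distribution function there. -/
lemma hasDerivAt_measureReal_Iic {ν : Measure ℝ} [IsFiniteMeasure ν] {f : ℝ → ℝ≥0∞}
    (hf : Measurable f)
    (hν : ν.restrict (Set.Ioi 0) = (volume.restrict (Set.Ioi 0)).withDensity f)
    (hfin : ∀ β, 0 < β → f β < ∞) (hcont : ∀ β, 0 < β → ContinuousAt (fun b => (f b).toReal) β)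
    {β : ℝ} (hβ : 0 < β) : HasDerivAt (fun b => ν.real (Set.Iic b)) (f β).toReal β := by
  have ha : 0 < β / 2 := half_pos hβ
  -- The base point `β / 2` keeps the integration away from `0`, where the density may blow up.
  have hint : IntervalIntegrable (fun b => (f b).toReal) volume (β / 2) β := by
    refine ContinuousOn.intervalIntegrable fun x hx => (hcont x ?_).continuousWithinAt
    rw [Set.uIcc_of_le (half_le_self hβ.le)] at hx
    exact ha.trans_le hx.1
  have hderiv := intervalIntegral.integral_hasDerivAt_right hint
    hf.ennreal_toReal.stronglyMeasurable.stronglyMeasurableAtFilter (hcont β hβ)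
  refine (hderiv.const_add (ν.real (Set.Iic (β / 2)))).congr_of_eventuallyEq ?_
  filter_upwards [lt_mem_nhds (half_lt_self hβ)] with b hb
  have hsub : Set.Ioc (β / 2) b ⊆ Set.Ioi 0 := fun x hx => ha.trans hx.1
  have hIoc : ν (Set.Ioc (β / 2) b) = ∫⁻ x in Set.Ioc (β / 2) b, f x := by
    rw [← Measure.restrict_eq_self ν hsub, hν, withDensity_apply _ measurableSet_Ioc,
      Measure.restrict_restrict measurableSet_Ioc, Set.inter_eq_left.2 hsub]
  rw [intervalIntegral.integral_of_le hb.le, integral_toReal hf.aemeasurable, ← hIoc,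
    ← Set.Iic_union_Ioc_eq_Iic hb.le]
  · exact measureReal_union (Set.Iic_disjoint_Ioc le_rfl) measurableSet_Ioc
  · exact (ae_restrict_mem measurableSet_Ioc).mono fun x hx => hfin x (hsub hx)

end Density

/-! ### Mixing over the independent time, and the main theorem. -/

/-- The law on `(0, ∞)` of the maximum of a Brownian path over `[0, c]` for an independent random
time `c`. -/
lemma prod_runningMax_apply {E : Type*} [MeasurableSpace E] {μ : Measure PathSpace} [SFinite μ]
    {π : Measure E} [SFinite π]
    (hμ : ∀ y, μ.map (runningMax coord y) = (gaussianReal 0 y).map (fun x => |x|))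
    {c : E → ℝ≥0} (hc : Measurable c) {A : Set ℝ} (hA : MeasurableSet A) (hA0 : A ⊆ Set.Ioi 0) :
    μ.prod π {p | runningMax coord (c p.2) p.1 ∈ A} =
      ∫⁻ β in A, 2 * ∫⁻ y, gaussianPDF 0 y β ∂(π.map c) := by
  have hR : Measurable fun p : ℝ≥0 × PathSpace => runningMax coord p.1 p.2 :=
    measurable_runningMax_uncurry continuous_coord measurable_coord
  have hm : MeasurableSet {p : PathSpace × E | runningMax coord (c p.2) p.1 ∈ A} :=
    (hR.comp ((hc.comp measurable_snd).prodMk measurable_fst)) hA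
  have hg : Measurable fun p : E × ℝ => 2 * gaussianPDF 0 (c p.1) p.2 :=
    (measurable_gaussianPDF_uncurry.comp
      ((hc.comp measurable_fst).prodMk measurable_snd)).const_mul 2
  rw [Measure.prod_apply_symm hm]
  calc ∫⁻ e, μ ((fun f => (f, e)) ⁻¹' {p : PathSpace × E | runningMax coord (c p.2) p.1 ∈ A}) ∂π
      = ∫⁻ e, (∫⁻ β in A, 2 * gaussianPDF 0 (c e) β) ∂π := by
        refine lintegral_congr fun e => ?_
        rw [← two_mul_gaussianReal_apply _ hA hA0, ← gaussianReal_map_abs_apply _ hA hA0, ← hμ,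
          Measure.map_apply (measurable_runningMax continuous_coord measurable_coord _) hA]
        rfl
    _ = ∫⁻ β in A, (∫⁻ e, 2 * gaussianPDF 0 (c e) β ∂π) :=
        lintegral_lintegral_swap hg.aemeasurable
    _ = _ := by
        refine lintegral_congr fun β => ?_
        have hβ : Measurable fun y : ℝ≥0 => gaussianPDF 0 y β :=
          measurable_gaussianPDF_uncurry.comp measurable_prodMk_right
        rw [lintegral_map hβ hc]
        exact lintegral_const_mul _ (hβ.comp hc)

variable {Ω : Type*} [MeasurableSpace Ω] {P : Measure Ω}

/-- The `σ`-algebra of `PathSpace` is pulled back from the product space, so each `Z j` generates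
the same `σ`-algebra as its underlying function and independence transfers. -/
lemma map_pathSpace_eq_pi [IsProbabilityMeasure P] {ι : Type*} [Fintype ι]
    {B : ι → ℝ≥0 → Ω → ℝ} {Z : ι → Ω → PathSpace} (hZm : ∀ j, Measurable (Z j))
    (hZ : ∀ j, ∀ᵐ ω ∂P, ∀ s, B j s ω = (Z j ω).1 s)
    (hindep : iIndepFun (fun j (ω : Ω) (s : ℝ≥0) => B j s ω) P) :
    P.map (fun ω j => Z j ω) = Measure.pi fun j => P.map (Z j) := by
  rw [← iIndepFun_iff_map_fun_eq_pi_map fun j => (hZm j).aemeasurable]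
  have h : iIndepFun (fun j (ω : Ω) => (Z j ω).1) P :=
    hindep.congr fun j => (hZ j).mono fun ω hω => funext hω
  rw [iIndepFun_iff_iIndep] at h ⊢
  convert h using 2 with j
  exact MeasurableSpace.comap_comp

end IteratedBM

open IteratedBM in
theorem theorem3p1 {Ω : Type*} [MeasurableSpace Ω] (P : Measure Ω) [IsProbabilityMeasure P]
    (n : ℕ) (B : Fin (n + 1) → ℝ≥0 → Ω → ℝ)
    (hB : ∀ j, IsBrownianReal (B j) P)
    (hindep : iIndepFun (fun (j : Fin (n + 1)) (ω : Ω) (s : ℝ≥0) => B j s ω) P)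
    (t : ℝ≥0) (ht : 0 < t) :
    -- the densities of the maxima of the reflecting Brownian motions exist
    (∀ j : Fin n, ∀ y : ℝ≥0, 0 < y →
      HasPDF (IteratedBM.runningMax (IteratedBM.reflecting (B j.succ)) y) P volume) ∧
    -- the maximum of the iterated Brownian motion has the stated density on `(0, ∞)`
    AEMeasurable (IteratedBM.runningMax (IteratedBM.iterated n B) t) P ∧
    (P.map (IteratedBM.runningMax (IteratedBM.iterated n B) t)).restrict (Set.Ioi 0) =
      (volume.restrict (Set.Ioi 0)).withDensity (IteratedBM.maxDensity P n B t) ∧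
    -- and at each `β > 0` that value is the derivative of the distribution function
    ∀ β : ℝ, 0 < β →
      IteratedBM.maxDensity P n B t β < ∞ ∧
      HasDerivAt (fun b : ℝ => P.real {ω | IteratedBM.runningMax (IteratedBM.iterated n B) t ω ≤ b})
        (IteratedBM.maxDensity P n B t β).toReal β := by
  choose Z hZm hZ using fun j => exists_pathSpace_version (hB j)
  have hpre (j) : IsPreBrownianReal (fun s ω => coord s (Z j ω)) P :=
    (hB j).toIsPreBrownianReal.congr fun s => (hZ j).mono fun ω hω => hω s
  have hcont (j) (ω : Ω) : Continuous fun s => coord s (Z j ω) := continuous_coord _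
  have hmeas (j s) : Measurable fun ω => coord s (Z j ω) := (measurable_coord s).comp (hZm j)
  have hzero (j) (ω : Ω) : coord 0 (Z j ω) = 0 := coord_zero _
  have hmax (j y) : runningMax (reflecting fun s ω => coord s (Z j ω)) y =ᵐ[P]
      runningMax (reflecting (B j)) y :=
    (hZ j).mono fun ω hω => by simp only [runningMax, reflecting, coord, hω]
  have hpdf (j) (y : ℝ≥0) (hy : 0 < y) : HasPDF (runningMax (reflecting (B j)) y) P volume :=
    HasPDF.congr (hmax j y)
      (hX := hasPDF_runningMax_reflecting (hpre j) (hcont j) (hmeas j) (hzero j) hy.ne')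
  let μ : Fin (n + 1) → Measure PathSpace := fun j => P.map (Z j)
  have hμ (j) : IsProbabilityMeasure (μ j) := Measure.isProbabilityMeasure_map (hZm j).aemeasurable
  have hmap (j y) : P.map (runningMax (reflecting (B j)) y) =
      (μ j).map (runningMax (reflecting coord) y) := by
    rw [← Measure.map_congr (hmax j y), Measure.map_map (measurable_runningMax
      (X := reflecting coord) (fun f => (continuous_coord f).abs)
      (fun s => (measurable_coord s).abs) y) (hZm j)]
    rfl
  have hμ0 (y) : (μ 0).map (runningMax coord y) = (gaussianReal 0 y).map (fun x => |x|) := by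
    rw [← map_runningMax (hpre 0) (hcont 0) (hmeas 0) (hzero 0) y,
      Measure.map_map (measurable_runningMax continuous_coord measurable_coord y) (hZm 0)]
    rfl
  let π : Measure (Fin n → PathSpace) := Measure.pi fun j => μ j.succ
  -- The law of the random time up to which the outer path is maximised.
  let ρ : Measure ℝ≥0 := π.map fun w => chain n w t
  have hρ : IsProbabilityMeasure ρ :=
    Measure.isProbabilityMeasure_map (measurable_chain_right n t).aemeasurable
  have hdens : maxDensity P n B t = fun β => 2 * ∫⁻ y, gaussianPDF 0 y β ∂ρ := by
    ext β
    have hβ : Measurable fun y : ℝ≥0 => gaussianPDF 0 y β :=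
      measurable_gaussianPDF_uncurry.comp measurable_prodMk_right
    rw [maxDensity, nestedIntegral_eq_lintegral_chain hβ (fun j => μ j.succ)
      (fun j => hpdf j.succ) (fun j => hmap j.succ) ht,
      lintegral_map hβ (measurable_chain_right n t)]
  have hdm : Measurable (maxDensity P n B t) := by
    rw [hdens]
    exact (measurable_gaussianPDF_uncurry.comp measurable_swap).lintegral_prod_right'.const_mul 2
  let R : PathSpace × (Fin n → PathSpace) → ℝ := fun p => runningMax coord (chain n p.2 t) p.1
  have hR : Measurable R := (measurable_runningMax_uncurry continuous_coord measurable_coord).comp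
    (((measurable_chain_right n t).comp measurable_snd).prodMk measurable_fst)
  have hsplit : MeasurePreserving (fun ω => (Z 0 ω, fun j : Fin n => Z j.succ ω)) P
      ((μ 0).prod π) := by
    have h1 : MeasurePreserving (fun ω j => Z j ω) P (Measure.pi μ) :=
      ⟨measurable_pi_lambda _ hZm, map_pathSpace_eq_pi hZm hZ hindep⟩
    exact (measurePreserving_piFinSuccAbove μ 0).comp h1
  have hM : (fun ω => R (Z 0 ω, fun j : Fin n => Z j.succ ω)) =ᵐ[P]
      runningMax (iterated n B) t := by
    filter_upwards [ae_all_iff.2 hZ] with ω hω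
    exact (runningMax_iterated (fun j => Z j ω) hω t).symm
  have hMm : AEMeasurable (runningMax (iterated n B) t) P :=
    ⟨_, hR.comp hsplit.measurable, hM.symm⟩
  have hlaw : P.map (runningMax (iterated n B) t) = ((μ 0).prod π).map R := by
    rw [← Measure.map_congr hM, ← hsplit.map_eq, Measure.map_map hR hsplit.measurable]
    rfl
  have hrestrict : (P.map (runningMax (iterated n B) t)).restrict (Set.Ioi 0) =
      (volume.restrict (Set.Ioi 0)).withDensity (maxDensity P n B t) := by
    ext A hA
    rw [Measure.restrict_apply hA, hlaw, Measure.map_apply hR (hA.inter measurableSet_Ioi),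
      withDensity_apply _ hA, Measure.restrict_restrict hA, hdens]
    exact prod_runningMax_apply hμ0 (measurable_chain_right n t) (hA.inter measurableSet_Ioi)
      Set.inter_subset_right
  have hfin (β : ℝ) (hβ : 0 < β) : maxDensity P n B t β < ∞ := by
    rw [hdens]
    exact ENNReal.mul_lt_top (by simp) (lintegral_gaussianPDF_lt_top ρ hβ)
  refine ⟨fun j => hpdf j.succ, hMm, hrestrict, fun β hβ => ⟨hfin β hβ, ?_⟩⟩
  have : IsProbabilityMeasure (P.map (runningMax (iterated n B) t)) :=
    Measure.isProbabilityMeasure_map hMm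
  have hderiv := hasDerivAt_measureReal_Iic hdm hrestrict hfin (fun b hb => by
    simp only [hdens, ENNReal.toReal_mul]
    exact (continuousAt_toReal_lintegral_gaussianPDF ρ hb).const_mul _) hβ
  simp only [map_measureReal_apply_of_aemeasurable hMm measurableSet_Iic] at hderiv
  exact hderiv
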